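/- Call an $n$-tuple $(x_1,\dots,x_n)\in[0,1]^n$ ($n\ge 3$) \emph{cyclic} if there exist independent real random variables $U_1,\dots,U_n$ with $P(U_i=U_j)=0$ for $i\ne j$ such that $P(U_{i+1}>U_i)=x_i$ for $i=1,\dots,n-1$ and $P(U_1>U_n)=x_n$; call it \emph{nontransitive} if it is cyclic and $x_i>1/2$ for all $i$. (i) A triple $(x_1,x_2,x_3)$ chosen uniformly at random from $[0,1]^3$ is cyclic with probability $$p_3=\frac{11\sqrt5}{4}-\frac{17}{4}-6\ln(\sqrt5-1)\approx 0.627575 .$$ (ii) A triple $(x_1,x_2,x_3)$ chosen uniformly at random from $[0,1]^3$ is nontransitive with probability $$p_3^*=\frac{11\sqrt5}{8}-\frac{43}{16}-3\ln(\sqrt5-1)+\frac{3\ln 2}{8}\approx 0.011217 .$$ Here the sets of cyclic and of nontransitive triples are Borel subsets of $[0,1]^3$, and both decimal approximations are accurate to within $10^{-6}$. -/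

import Mathlib

open MeasureTheory ProbabilityTheory

/-- An `n`-tuple `x` in `[0,1]^n` is cyclic if there are independent real random variables
`U i` on some probability space, pairwise distinct almost surely, with
`P(U (i+1) > U i) = x i` for all `i`. The addition in `Fin n` is modulo `n`, so that for the
last index the condition reads `P(U 0 > U (n-1)) = x (n-1)`. -/
def IsCyclicTuple {n : ℕ} [NeZero n] (x : Fin n → ℝ) : Prop :=
  (∀ i, x i ∈ Set.Icc (0 : ℝ) 1) ∧
  ∃ (Ω : Type) (_ : MeasurableSpace Ω) (P : Measure Ω) (_ : IsProbabilityMeasure P)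
    (U : Fin n → Ω → ℝ),
    (∀ i, Measurable (U i)) ∧
    iIndepFun U P ∧
    (∀ i j, i ≠ j → P {ω | U i ω = U j ω} = 0) ∧
    ∀ i, P.real {ω | U (i + 1) ω > U i ω} = x i

/-- A nontransitive tuple: cyclic, with all coordinates greater than `1/2`. -/
def IsNontransitiveTuple {n : ℕ} [NeZero n] (x : Fin n → ℝ) : Prop :=
  IsCyclicTuple x ∧ ∀ i, x i > 1 / 2

/-- The value `p_3`. -/
noncomputable def pThree : ℝ :=
  11 * √5 / 4 - 17 / 4 - 6 * Real.log (√5 - 1)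

/-- The value `p_3^*`. -/
noncomputable def pThreeStar : ℝ :=
  11 * √5 / 8 - 43 / 16 - 3 * Real.log (√5 - 1) + 3 * Real.log 2 / 8

/-! A triple in the cube is cyclic iff neither it nor its reflection `1 - x` is excessive
(`isCyclicTuple_iff`). Necessity is Trybuła's inequality. By Fubini over the third variable `k`, the
pair `(P(g < k), P(k < f))` is a mean of points of the curve `t ↦ (P(g < t), P(f > t))`. Any point
of the convex hull of a plane set is dominated by a mixture of two points of the set, and excess is
an open, monotone condition, so `k` may be taken two-valued; a polynomial inequality then decides
(`not_excessive_of_two_point`). Negating the variables handles `1 - x`. For sufficiency, a constant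
third variable realises every `x` between `(1 - y)(1 - z)` and `1 - yz`, and cyclic shifts of this
construction cover all remaining triples.

The excessive set and its reflection are disjoint and of equal volume `E`, so `p₃ = 1 - 2E`; sorting
coordinates reduces `E` to six times an iterated integral. Reflected excessive triples never have
all coordinates above `1/2`, and an excessive triple has at most one coordinate `≤ 1/2`. Hence `p₃*
= 1/8 - (E - 3L)`, where `L` is the volume of the excessive triples whose first coordinate is `≤
1/2`. -/

/-- All three of `x + yz`, `y + xz`, `z + xy` exceed `1`. -/
def Excessive (x y z : ℝ) : Prop :=
  1 < x + y * z ∧ 1 < y + x * z ∧ 1 < z + x * y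

lemma Excessive.mono {x x' y y' z z' : ℝ} (h : Excessive x y z) (hx0 : 0 ≤ x) (hy0 : 0 ≤ y)
    (hz0 : 0 ≤ z) (hx : x ≤ x') (hy : y ≤ y') (hz : z ≤ z') : Excessive x' y' z' := by
  obtain ⟨h1, h2, h3⟩ := h
  have e1 : y * z ≤ y' * z' := mul_le_mul hy hz hz0 (hy0.trans hy)
  have e2 : x * z ≤ x' * z' := mul_le_mul hx hz hz0 (hx0.trans hx)
  have e3 : x * y ≤ x' * y' := mul_le_mul hx hy hy0 (hx0.trans hx)
  exact ⟨by linarith, by linarith, by linarith⟩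

/-! ### The inequality for a two-valued third variable -/

/-- The half of `not_excessive_of_two_point` in which the upper threshold has the larger weight. -/
lemma mul_le_one_sub_of_two_point {r s a v b u : ℝ} (hs : 0 ≤ s) (hsr : s ≤ r)
    (hrs : r + s = 1) (ha : 0 ≤ a) (hv : 0 ≤ v) (hb : 0 ≤ b) (hu : 0 ≤ u)
    (hav : a + v ≤ 1) (hbu : b + u ≤ 1) (hva : v ≤ r * a) (hub : u ≤ s * b) :
    (1 - a * u - v * u - v * b) * (r * b + u) ≤ 1 - v - s * a := by
  have hr : 0 ≤ r := hs.trans hsr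
  obtain rfl : r = 1 - s := by linarith
  have hb1 : b ≤ 1 := by linarith
  have ha1 : a ≤ 1 := by linarith
  have hB : (1 - s) * b + u ≤ b := by nlinarith
  have hB0 : 0 ≤ (1 - s) * b + u := by positivity
  -- raising `a` to `1 - v`
  have k1 : u * ((1 - s) * b + u) ≤ s := by
    have : u * ((1 - s) * b + u) ≤ u * b := mul_le_mul_of_nonneg_left hB hu
    nlinarith
  have k2 : 0 ≤ (1 - v - a) * (s - u * ((1 - s) * b + u)) :=
    mul_nonneg (by linarith) (by linarith)
  -- raising `b` to `1 - u`
  have hv2 : v * ((1 - s) * b + u) ≤ (1 - s) * (a * b) := by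
    calc v * ((1 - s) * b + u) ≤ ((1 - s) * a) * b := mul_le_mul hva hB hB0 (by positivity)
      _ = _ := by ring
  have k3 : 0 ≤ (1 - u - b) * ((1 - s) * (1 - u - v * (1 - u)) - v * ((1 - s) * b + u)) := by
    apply mul_nonneg (by linarith)
    have : a * b ≤ (1 - v) * (1 - u) := mul_le_mul (by linarith) (by linarith) hb (by linarith)
    have := mul_le_mul_of_nonneg_left this hr
    nlinarith
  -- The difference of the two sides at `a = 1 - v`, `b = 1 - u`; `s ≤ r` is essential here. The
  -- difference in general is exactly the sum of the expressions in `k2`, `k3`, `k4`.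
  have k4 : 0 ≤ (1 - v) * u * ((1 - s) - s + s * u) := by
    have : 0 ≤ s * u := mul_nonneg hs hu
    exact mul_nonneg (mul_nonneg (by linarith) hu) (by linarith)
  nlinarith

/-- The third variable takes values `t₁ ≤ t₂` with weights `s`, `r`; `f` has mass `a` on `(t₁, t₂]`
and `v` above, `g` has mass `u` below `t₁` and `b` on `[t₁, t₂)`. Reversing the line swaps `r, a, v`
with `s, b, u`, so the case `s ≤ r` suffices. -/
lemma not_excessive_of_two_point {r s a v b u x : ℝ} (hr : 0 ≤ r) (hs : 0 ≤ s)
    (hrs : r + s = 1) (ha : 0 ≤ a) (hv : 0 ≤ v) (hb : 0 ≤ b) (hu : 0 ≤ u)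
    (hav : a + v ≤ 1) (hbu : b + u ≤ 1) (hx : x ≤ 1 - a * u - v * u - v * b) :
    ¬ Excessive x (r * b + u) (s * a + v) := by
  rintro ⟨h1, h2, h3⟩
  -- The first excess inequality, expanded. It forces `v ≤ r a` and `u ≤ s b`; then one of the other
  -- two fails, depending on which weight is larger.
  have key : r * (a * u) + s * (v * b) < r * s * (a * b) := by
    have : r * (a * u) + s * (v * b) = a * u + v * b - s * (a * u) - r * (v * b) := by
      obtain rfl : r = 1 - s := by linarith
      ring
    nlinarith
  have hab : 0 < r * s * (a * b) := lt_of_le_of_lt (by positivity) key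
  have hr' : 0 < r := hr.lt_of_ne (by rintro rfl; simp at hab)
  have hs' : 0 < s := hs.lt_of_ne (by rintro rfl; simp at hab)
  have ha' : 0 < a := ha.lt_of_ne (by rintro rfl; simp at hab)
  have hb' : 0 < b := hb.lt_of_ne (by rintro rfl; simp at hab)
  have hva : v ≤ r * a := by
    have h : (s * b) * v ≤ (s * b) * (r * a) := by
      have : 0 ≤ r * (a * u) := by positivity
      nlinarith
    exact le_of_mul_le_mul_left h (by positivity)
  have hub : u ≤ s * b := by
    have h : (r * a) * u ≤ (r * a) * (s * b) := by
      have : 0 ≤ s * (v * b) := by positivity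
      nlinarith
    exact le_of_mul_le_mul_left h (by positivity)
  rcases le_total s r with h | h
  · have e := mul_le_one_sub_of_two_point hs h hrs ha hv hb hu hav hbu hva hub
    have : x * (r * b + u) ≤ (1 - a * u - v * u - v * b) * (r * b + u) :=
      mul_le_mul_of_nonneg_right hx (by positivity)
    linarith
  · have e := mul_le_one_sub_of_two_point hr h (by linarith) hb hu ha hv hbu hav hub hva
    have : x * (s * a + v) ≤ (1 - b * v - u * v - u * a) * (s * a + v) :=
      mul_le_mul_of_nonneg_right (by linarith) (by positivity)
    linarith

/-! ### Domination by two points in the plane -/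

/-- In the plane, a nonnegative combination of three points is dominated by one of two of them,
with the same total weight. -/
lemma exists_two_point_dominating_of_sorted {p₀ p₁ p₂ : ℝ × ℝ} {w₀ w₁ w₂ : ℝ}
    (h₀ : 0 ≤ w₀) (h₁ : 0 ≤ w₁) (h₂ : 0 ≤ w₂) (h01 : p₀.1 ≤ p₁.1) (h12 : p₁.1 ≤ p₂.1) :
    ∃ q ∈ ({p₀, p₁, p₂} : Set (ℝ × ℝ)), ∃ q' ∈ ({p₀, p₁, p₂} : Set (ℝ × ℝ)), ∃ α β : ℝ,
      0 ≤ α ∧ 0 ≤ β ∧ α + β = w₀ + w₁ + w₂ ∧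
      w₀ • p₀ + w₁ • p₁ + w₂ • p₂ ≤ α • q + β • q' := by
  obtain ⟨y₀, z₀⟩ := p₀
  obtain ⟨y₁, z₁⟩ := p₁
  obtain ⟨y₂, z₂⟩ := p₂
  simp only at h01 h12
  obtain ⟨θ, hθ0, hθ1, hθ⟩ : ∃ θ : ℝ, 0 ≤ θ ∧ θ ≤ 1 ∧ y₁ = (1 - θ) * y₀ + θ * y₂ := by
    rcases eq_or_lt_of_le (h01.trans h12) with h | h
    · exact ⟨0, le_rfl, zero_le_one, by linarith⟩
    · have : 0 < y₂ - y₀ := by linarith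
      refine ⟨(y₁ - y₀) / (y₂ - y₀), div_nonneg (by linarith) this.le,
        (div_le_one this).2 (by linarith), ?_⟩
      field_simp
      ring
  subst hθ
  -- If the middle point lies below the chord, its mass is split between the ends.
  rcases le_total z₁ ((1 - θ) * z₀ + θ * z₂) with hz | hz
  · refine ⟨(y₀, z₀), by simp, (y₂, z₂), by simp, w₀ + (1 - θ) * w₁, w₂ + θ * w₁,
      add_nonneg h₀ (mul_nonneg (by linarith) h₁), add_nonneg h₂ (mul_nonneg hθ0 h₁), by ring, ?_⟩
    simp only [Prod.smul_mk, Prod.mk_add_mk, smul_eq_mul, Prod.mk_le_mk]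
    refine ⟨by linarith, ?_⟩
    have := mul_le_mul_of_nonneg_left hz h₁
    linarith
  -- Above the chord, mass `τ` of the chord point under the middle one is drawn from the ends and
  -- lifted to the middle, with `τ` chosen to exhaust one end.
  · rcases le_total (w₀ * θ) (w₂ * (1 - θ)) with hw | hw
    · obtain ⟨τ, hτ0, hτ⟩ : ∃ τ : ℝ, 0 ≤ τ ∧ w₀ = τ * (1 - θ) ∧ θ * τ ≤ w₂ := by
        rcases eq_or_lt_of_le hθ1 with h | h
        · subst h
          exact ⟨0, le_rfl, by linarith, by linarith⟩
        · have h' : 0 < 1 - θ := by linarith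
          refine ⟨w₀ / (1 - θ), div_nonneg h₀ h'.le, by field_simp, ?_⟩
          rw [← mul_div_assoc, div_le_iff₀ h']
          linarith
      obtain ⟨rfl, hτ⟩ := hτ
      refine ⟨((1 - θ) * y₀ + θ * y₂, z₁), by simp, (y₂, z₂), by simp, w₁ + τ, w₂ - θ * τ,
        add_nonneg h₁ hτ0, by linarith, by ring, ?_⟩
      simp only [Prod.smul_mk, Prod.mk_add_mk, smul_eq_mul, Prod.mk_le_mk]
      refine ⟨by linarith, ?_⟩
      have := mul_le_mul_of_nonneg_left hz hτ0
      linarith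
    · obtain ⟨τ, hτ0, hτ⟩ : ∃ τ : ℝ, 0 ≤ τ ∧ w₂ = τ * θ ∧ (1 - θ) * τ ≤ w₀ := by
        rcases eq_or_lt_of_le hθ0 with h | h
        · subst h
          exact ⟨0, le_rfl, by linarith, by linarith⟩
        · refine ⟨w₂ / θ, div_nonneg h₂ h.le, by field_simp, ?_⟩
          rw [← mul_div_assoc, div_le_iff₀ h]
          linarith
      obtain ⟨rfl, hτ⟩ := hτ
      refine ⟨(y₀, z₀), by simp, ((1 - θ) * y₀ + θ * y₂, z₁), by simp, w₀ - (1 - θ) * τ, w₁ + τ,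
        by linarith, add_nonneg h₁ hτ0, by ring, ?_⟩
      simp only [Prod.smul_mk, Prod.mk_add_mk, smul_eq_mul, Prod.mk_le_mk]
      refine ⟨by linarith, ?_⟩
      have := mul_le_mul_of_nonneg_left hz hτ0
      linarith

lemma exists_two_point_dominating {S : Set (ℝ × ℝ)} {p₀ p₁ p₂ : ℝ × ℝ} {w₀ w₁ w₂ : ℝ}
    (hp₀ : p₀ ∈ S) (hp₁ : p₁ ∈ S) (hp₂ : p₂ ∈ S)
    (h₀ : 0 ≤ w₀) (h₁ : 0 ≤ w₁) (h₂ : 0 ≤ w₂) :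
    ∃ q ∈ S, ∃ q' ∈ S, ∃ α β : ℝ,
      0 ≤ α ∧ 0 ≤ β ∧ α + β = w₀ + w₁ + w₂ ∧
      w₀ • p₀ + w₁ • p₁ + w₂ • p₂ ≤ α • q + β • q' := by
  have main : ∀ {p₀ p₁ p₂ : ℝ × ℝ} {w₀ w₁ w₂ : ℝ}, p₀ ∈ S → p₁ ∈ S → p₂ ∈ S →
      0 ≤ w₀ → 0 ≤ w₁ → 0 ≤ w₂ → p₀.1 ≤ p₁.1 → p₁.1 ≤ p₂.1 →
      ∃ q ∈ S, ∃ q' ∈ S, ∃ α β : ℝ, 0 ≤ α ∧ 0 ≤ β ∧ α + β = w₀ + w₁ + w₂ ∧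
      w₀ • p₀ + w₁ • p₁ + w₂ • p₂ ≤ α • q + β • q' := by
    intro p₀ p₁ p₂ w₀ w₁ w₂ hp₀ hp₁ hp₂ h₀ h₁ h₂ h01 h12
    obtain ⟨q, hq, q', hq', h⟩ := exists_two_point_dominating_of_sorted h₀ h₁ h₂ h01 h12
    have hS : ({p₀, p₁, p₂} : Set (ℝ × ℝ)) ⊆ S := by
      rintro p (rfl | rfl | rfl) <;> assumption
    exact ⟨q, hS hq, q', hS hq', h⟩
  rcases le_total p₀.1 p₁.1 with a | a <;> rcases le_total p₁.1 p₂.1 with b | b <;>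
    rcases le_total p₀.1 p₂.1 with c | c
  · exact main hp₀ hp₁ hp₂ h₀ h₁ h₂ a b
  · exact main hp₀ hp₁ hp₂ h₀ h₁ h₂ a b
  · have := main hp₀ hp₂ hp₁ h₀ h₂ h₁ c b
    rwa [add_right_comm w₀, add_right_comm (w₀ • p₀)] at this
  · have := main hp₂ hp₀ hp₁ h₂ h₀ h₁ c a
    rwa [add_assoc w₂, add_assoc (w₂ • p₂), add_comm w₂, add_comm (w₂ • p₂)] at this
  · have := main hp₁ hp₀ hp₂ h₁ h₀ h₂ a c
    rwa [add_comm w₁, add_comm (w₁ • p₁)] at this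
  · have := main hp₁ hp₂ hp₀ h₁ h₂ h₀ b c
    rwa [add_comm _ w₀, add_comm _ (w₀ • p₀), ← add_assoc, ← add_assoc] at this
  · have := main hp₂ hp₁ hp₀ h₂ h₁ h₀ b a
    rwa [add_comm _ w₀, add_comm _ (w₀ • p₀), add_comm w₂, add_comm (w₂ • p₂), ← add_assoc,
      ← add_assoc] at this
  · have := main hp₂ hp₁ hp₀ h₂ h₁ h₀ b a
    rwa [add_comm _ w₀, add_comm _ (w₀ • p₀), add_comm w₂, add_comm (w₂ • p₂), ← add_assoc,
      ← add_assoc] at this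

/-- Every point of the convex hull of a plane set is dominated by a point of a segment between two
points of the set. -/
lemma exists_segment_dominating {S : Set (ℝ × ℝ)} {p : ℝ × ℝ} (hp : p ∈ convexHull ℝ S) :
    ∃ q ∈ S, ∃ q' ∈ S, ∃ α β : ℝ, 0 ≤ α ∧ 0 ≤ β ∧ α + β = 1 ∧ p ≤ α • q + β • q' := by
  let D : Set (ℝ × ℝ) := {p | ∃ q ∈ S, ∃ q' ∈ S, ∃ α β : ℝ,
    0 ≤ α ∧ 0 ≤ β ∧ α + β = 1 ∧ p ≤ α • q + β • q'}
  suffices h : convexHull ℝ S ⊆ D from h hp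
  apply convexHull_min
  · intro q hq
    exact ⟨q, hq, q, hq, 1, 0, zero_le_one, le_rfl, by norm_num, by simp⟩
  · rintro p ⟨q₀, hq₀, q₁, hq₁, α, β, hα, hβ, hαβ, hle⟩ p' ⟨q₂, hq₂, q₃, hq₃, α', β', hα', hβ',
      hαβ', hle'⟩ s t hs ht hst
    obtain ⟨e₀, he₀, e₁, he₁, γ, δ, hγ, hδ, hγδ, h1⟩ := exists_two_point_dominating hq₀ hq₁ hq₂
      (mul_nonneg hs hα) (mul_nonneg hs hβ) (mul_nonneg ht hα')
    obtain ⟨f₀, hf₀, f₁, hf₁, ε, ζ, hε, hζ, hεζ, h2⟩ := exists_two_point_dominating he₀ he₁ hq₃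
      hγ hδ (mul_nonneg ht hβ')
    refine ⟨f₀, hf₀, f₁, hf₁, ε, ζ, hε, hζ, ?_, ?_⟩
    · rw [hεζ, hγδ]
      linear_combination s * hαβ + t * hαβ' + hst
    · calc s • p + t • p' ≤ s • (α • q₀ + β • q₁) + t • (α' • q₂ + β' • q₃) :=
            add_le_add (smul_le_smul_of_nonneg_left hle hs) (smul_le_smul_of_nonneg_left hle' ht)
        _ = ((s * α) • q₀ + (s * β) • q₁ + (t * α') • q₂) + (t * β') • q₃ := by
            simp only [smul_add, smul_smul]
            abel
        _ ≤ γ • e₀ + δ • e₁ + (t * β') • q₃ := by gcongr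
        _ ≤ _ := h2

/-! ### Trybuła's inequality for independent variables -/

lemma measureReal_lt_eq_integral_Iio {Ω : Type*} [MeasurableSpace Ω] {P : Measure Ω}
    [IsProbabilityMeasure P] {f g : Ω → ℝ} (hf : Measurable f) (hg : Measurable g)
    (h : IndepFun f g P) :
    P.real {ω | f ω < g ω} = ∫ t, (P.map f).real (Set.Iio t) ∂(P.map g) := by
  have hm : MeasurableSet {p : ℝ × ℝ | p.2 < p.1} := measurableSet_lt measurable_snd measurable_fst
  have := Measure.isProbabilityMeasure_map (μ := P) hf.aemeasurable
  have := Measure.isProbabilityMeasure_map (μ := P) hg.aemeasurable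
  have e : P {ω | f ω < g ω} = ∫⁻ t, (P.map f) (Set.Iio t) ∂(P.map g) := by
    have := (indepFun_iff_map_prod_eq_prod_map_map hg.aemeasurable hf.aemeasurable).1 h.symm
    have e2 := Measure.prod_apply (μ := P.map g) (ν := P.map f) hm
    rw [← this, Measure.map_apply (hg.prodMk hf) hm] at e2
    exact e2
  rw [measureReal_def, e, ← integral_toReal]
  · rfl
  · exact (measurable_measure_prodMk_left hm).aemeasurable
  · exact Filter.Eventually.of_forall fun _ => measure_lt_top _ _

lemma measureReal_lt_eq_integral_Ioi {Ω : Type*} [MeasurableSpace Ω] {P : Measure Ω}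
    [IsProbabilityMeasure P] {f g : Ω → ℝ} (hf : Measurable f) (hg : Measurable g)
    (h : IndepFun f g P) :
    P.real {ω | f ω < g ω} = ∫ t, (P.map g).real (Set.Ioi t) ∂(P.map f) := by
  have hm : MeasurableSet {p : ℝ × ℝ | p.1 < p.2} := measurableSet_lt measurable_fst measurable_snd
  have := Measure.isProbabilityMeasure_map (μ := P) hf.aemeasurable
  have := Measure.isProbabilityMeasure_map (μ := P) hg.aemeasurable
  have e : P {ω | f ω < g ω} = ∫⁻ t, (P.map g) (Set.Ioi t) ∂(P.map f) := by
    have := (indepFun_iff_map_prod_eq_prod_map_map hf.aemeasurable hg.aemeasurable).1 h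
    have e2 := Measure.prod_apply (μ := P.map f) (ν := P.map g) hm
    rw [← this, Measure.map_apply (hf.prodMk hg) hm] at e2
    exact e2
  rw [measureReal_def, e, ← integral_toReal]
  · rfl
  · exact (measurable_measure_prodMk_left hm).aemeasurable
  · exact Filter.Eventually.of_forall fun _ => measure_lt_top _ _

lemma not_excessive_of_le_thresholds {Ω : Type*} [MeasurableSpace Ω] {P : Measure Ω}
    [IsProbabilityMeasure P] {f g : Ω → ℝ} (hf : Measurable f) (hg : Measurable g)
    (h : IndepFun f g P) {t₁ t₂ s r : ℝ} (ht : t₁ ≤ t₂) (hs : 0 ≤ s) (hr : 0 ≤ r)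
    (hsr : s + r = 1) :
    ¬ Excessive (P.real {ω | f ω < g ω})
      (s * (P.map g).real (Set.Iio t₁) + r * (P.map g).real (Set.Iio t₂))
      (s * (P.map f).real (Set.Ioi t₁) + r * (P.map f).real (Set.Ioi t₂)) := by
  simp only [map_measureReal_apply hf measurableSet_Ioi, map_measureReal_apply hg measurableSet_Iio]
  have mb1 : P.real (g ⁻¹' Set.Iio t₂) =
      P.real (g ⁻¹' Set.Iio t₁) + P.real (g ⁻¹' Set.Ico t₁ t₂) := by
    rw [← measureReal_union _ (hg measurableSet_Ico), ← Set.preimage_union,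
      Set.Iio_union_Ico_eq_Iio ht]
    apply Disjoint.preimage
    rw [Set.disjoint_left]
    intro a ha hb
    exact absurd ha (not_lt.2 hb.1)
  have ma1 : P.real (f ⁻¹' Set.Ioi t₁) =
      P.real (f ⁻¹' Set.Ioi t₂) + P.real (f ⁻¹' Set.Ioc t₁ t₂) := by
    rw [← measureReal_union _ (hf measurableSet_Ioc), ← Set.preimage_union, Set.union_comm,
      Set.Ioc_union_Ioi_eq_Ioi ht]
    apply Disjoint.preimage
    rw [Set.disjoint_left]
    intro a ha hb
    exact absurd ha (not_lt.2 hb.2)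
  have hu := measureReal_nonneg (μ := P) (s := g ⁻¹' Set.Iio t₁)
  have hb := measureReal_nonneg (μ := P) (s := g ⁻¹' Set.Ico t₁ t₂)
  have hv := measureReal_nonneg (μ := P) (s := f ⁻¹' Set.Ioi t₂)
  have ha := measureReal_nonneg (μ := P) (s := f ⁻¹' Set.Ioc t₁ t₂)
  have hbu := measureReal_le_one (μ := P) (s := g ⁻¹' Set.Iio t₂)
  have hav := measureReal_le_one (μ := P) (s := f ⁻¹' Set.Ioi t₁)
  -- Two disjoint rectangles, each separated by a threshold, lie inside `{g < f}`; independence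
  -- gives their masses.
  have hx : P.real {ω | f ω < g ω} ≤ 1 - P.real (f ⁻¹' Set.Ioi t₁) * P.real (g ⁻¹' Set.Iio t₁)
      - P.real (f ⁻¹' Set.Ioi t₂) * P.real (g ⁻¹' Set.Ico t₁ t₂) := by
    have e1 := congrArg ENNReal.toReal (h.measure_inter_preimage_eq_mul (Set.Ioi t₁) (Set.Iio t₁)
      measurableSet_Ioi measurableSet_Iio)
    have e2 := congrArg ENNReal.toReal (h.measure_inter_preimage_eq_mul (Set.Ioi t₂)
      (Set.Ico t₁ t₂) measurableSet_Ioi measurableSet_Ico)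
    rw [ENNReal.toReal_mul] at e1 e2
    simp only [← measureReal_def] at e1 e2
    rw [← e1, ← e2]
    have d1 : Disjoint (f ⁻¹' Set.Ioi t₁ ∩ g ⁻¹' Set.Iio t₁)
        (f ⁻¹' Set.Ioi t₂ ∩ g ⁻¹' Set.Ico t₁ t₂) := by
      rw [Set.disjoint_left]
      rintro ω ⟨_, h1⟩ ⟨_, h2⟩
      exact absurd h1 (not_lt.2 h2.1)
    have d2 : Disjoint {ω | f ω < g ω}
        ((f ⁻¹' Set.Ioi t₁ ∩ g ⁻¹' Set.Iio t₁) ∪ (f ⁻¹' Set.Ioi t₂ ∩ g ⁻¹' Set.Ico t₁ t₂)) := by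
      rw [Set.disjoint_left]
      rintro ω h0 (⟨h1, h2⟩ | ⟨h1, h2⟩)
      · exact lt_asymm (h0 : f ω < g ω) (lt_trans (show g ω < t₁ from h2) (show t₁ < f ω from h1))
      · exact lt_asymm (h0 : f ω < g ω) (lt_trans (show g ω < t₂ from h2.2) (show t₂ < f ω from h1))
    have m1 := (hf (measurableSet_Ioi (a := t₁))).inter (hg (measurableSet_Iio (a := t₁)))
    have m2 := (hf (measurableSet_Ioi (a := t₂))).inter (hg (measurableSet_Ico (a := t₁) (b := t₂)))
    have s1 := measureReal_union (μ := P) d1 m2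
    have s2 := measureReal_union (μ := P) d2 (m1.union m2)
    have := measureReal_le_one (μ := P) (s := {ω | f ω < g ω} ∪
        ((f ⁻¹' Set.Ioi t₁ ∩ g ⁻¹' Set.Iio t₁) ∪ (f ⁻¹' Set.Ioi t₂ ∩ g ⁻¹' Set.Ico t₁ t₂)))
    linarith
  rw [mb1] at hbu ⊢
  rw [ma1] at hav hx ⊢
  have := not_excessive_of_two_point (x := P.real {ω | f ω < g ω}) hr hs (by linarith) ha hv hb hu
    (by linarith) (by linarith) (by linarith)
  convert this using 2
  · linear_combination P.real (g ⁻¹' Set.Iio t₁) * hsr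
  · linear_combination P.real (f ⁻¹' Set.Ioi t₂) * hsr

/-- Trybuła's inequality. -/
lemma not_excessive_of_indep {Ω : Type*} [MeasurableSpace Ω] {P : Measure Ω}
    [IsProbabilityMeasure P] {f g k : Ω → ℝ} (hf : Measurable f) (hg : Measurable g)
    (hk : Measurable k) (hfg : IndepFun f g P) (hgk : IndepFun g k P) (hkf : IndepFun k f P) :
    ¬ Excessive (P.real {ω | f ω < g ω}) (P.real {ω | g ω < k ω}) (P.real {ω | k ω < f ω}) := by
  intro hex
  have := Measure.isProbabilityMeasure_map (μ := P) hk.aemeasurable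
  have := Measure.isProbabilityMeasure_map (μ := P) hg.aemeasurable
  have := Measure.isProbabilityMeasure_map (μ := P) hf.aemeasurable
  set x := P.real {ω | f ω < g ω} with hx
  let G : ℝ → ℝ × ℝ := fun t => ((P.map g).real (Set.Iio t), (P.map f).real (Set.Ioi t))
  have hG1 : Integrable (fun t => (P.map g).real (Set.Iio t)) (P.map k) := by
    apply Integrable.of_bound (C := 1)
    · apply Measurable.aestronglyMeasurable
      apply Monotone.measurable
      intro a b hab
      exact measureReal_mono (Set.Iio_subset_Iio hab)
    · exact Filter.Eventually.of_forall fun t => by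
        rw [Real.norm_of_nonneg measureReal_nonneg]; exact measureReal_le_one
  have hG2 : Integrable (fun t => (P.map f).real (Set.Ioi t)) (P.map k) := by
    apply Integrable.of_bound (C := 1)
    · apply Measurable.aestronglyMeasurable
      apply Antitone.measurable
      intro a b hab
      exact measureReal_mono (Set.Ioi_subset_Ioi hab)
    · exact Filter.Eventually.of_forall fun t => by
        rw [Real.norm_of_nonneg measureReal_nonneg]; exact measureReal_le_one
  have hmem : ∫ t, G t ∂(P.map k) ∈ closure (convexHull ℝ (Set.range G)) :=
    (convex_convexHull ℝ _).closure.integral_mem isClosed_closure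
      (Filter.Eventually.of_forall fun t =>
        subset_closure (subset_convexHull ℝ _ (Set.mem_range_self t))) (hG1.prodMk hG2)
  rw [integral_pair hG1 hG2, ← measureReal_lt_eq_integral_Iio hg hk hgk,
    ← measureReal_lt_eq_integral_Ioi hk hf hkf] at hmem
  -- The mean is only known to lie in the closure of the hull; openness moves it into the hull
  -- itself.
  have hopen : IsOpen {p : ℝ × ℝ | Excessive x p.1 p.2} := by
    simp only [Excessive, Set.ofPred_and]
    refine IsOpen.inter ?_ (IsOpen.inter ?_ ?_) <;> exact isOpen_lt (by fun_prop) (by fun_prop)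
  obtain ⟨p, hp, hpH⟩ := mem_closure_iff.1 hmem _ hopen hex
  have hp0 : 0 ≤ p.1 ∧ 0 ≤ p.2 := by
    have hc : Convex ℝ {p : ℝ × ℝ | 0 ≤ p} := convex_Ici (0 : ℝ × ℝ)
    have : convexHull ℝ (Set.range G) ⊆ {p : ℝ × ℝ | 0 ≤ p} := by
      refine convexHull_min ?_ hc
      rintro _ ⟨t, rfl⟩
      exact ⟨measureReal_nonneg, measureReal_nonneg⟩
    exact this hpH
  obtain ⟨_, ⟨t₁, rfl⟩, _, ⟨t₂, rfl⟩, s, r, hs, hr, hsr, hle⟩ := exists_segment_dominating hpH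
  have hp' := Excessive.mono hp measureReal_nonneg hp0.1 hp0.2 le_rfl hle.1 hle.2
  simp only [G, Prod.smul_mk, Prod.mk_add_mk, smul_eq_mul] at hp'
  rcases le_total t₁ t₂ with ht | ht
  · exact not_excessive_of_le_thresholds hf hg hfg ht hs hr hsr hp'
  · refine not_excessive_of_le_thresholds hf hg hfg ht hr hs (by linarith) ?_
    convert hp' using 1 <;> exact add_comm _ _

lemma IsCyclicTuple.not_excessive {x : Fin 3 → ℝ} (h : IsCyclicTuple x) :
    ¬ Excessive (x 0) (x 1) (x 2) ∧ ¬ Excessive (1 - x 0) (1 - x 1) (1 - x 2) := by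
  obtain ⟨-, Ω, _, P, _, U, hU, hI, hne, hx⟩ := h
  have hx0 := hx 0
  have hx1 := hx 1
  have hx2 := hx 2
  -- Negation reverses every comparison, and absence of ties makes the reversed event the complement
  -- up to a null set.
  have hrev : ∀ i, P.real {ω | -U i ω < -U (i + 1) ω} = 1 - x i := by
    intro i
    have hm : MeasurableSet {ω | U (i + 1) ω > U i ω} := measurableSet_lt (hU _) (hU _)
    rw [← hx i, ← probReal_compl_eq_one_sub hm]
    apply measureReal_congr
    have : ∀ᵐ ω ∂P, U i ω ≠ U (i + 1) ω := by
      rw [ae_iff]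
      simpa using hne i (i + 1) (by fin_cases i <;> decide)
    filter_upwards [this] with ω hω
    apply propext
    change -U i ω < -U (i + 1) ω ↔ ¬ (U i ω < U (i + 1) ω)
    rw [neg_lt_neg_iff, not_lt]
    exact ⟨le_of_lt, fun h => lt_of_le_of_ne h (Ne.symm hω)⟩
  constructor
  · rw [← hx0, ← hx1, ← hx2]
    exact not_excessive_of_indep (hU 0) (hU 1) (hU 2) (hI.indepFun (by decide))
      (hI.indepFun (by decide)) (hI.indepFun (by decide))
  · intro h
    have h01 := hrev 0
    have h12 := hrev 1
    have h20 := hrev 2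
    rw [← h01, ← h12, ← h20] at h
    have hn : ∀ i j, i ≠ j → IndepFun (fun ω => -U i ω) (fun ω => -U j ω) P := fun i j hij =>
      (hI.indepFun hij).comp measurable_neg measurable_neg
    exact not_excessive_of_indep (hU 0).neg (hU 1).neg (hU 2).neg (hn _ _ (by decide))
      (hn _ _ (by decide)) (hn _ _ (by decide)) h

/-! ### Realising triples; the characterisation of cyclic triples -/

lemma IsCyclicTuple.of_shift {n : ℕ} [NeZero n] {x : Fin n → ℝ}
    (h : IsCyclicTuple fun i => x (i + 1)) : IsCyclicTuple x := by
  obtain ⟨hx, Ω, _, P, hP, U, hU, hI, hne, hp⟩ := h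
  refine ⟨fun i => by simpa using hx (i - 1), Ω, _, P, hP, fun i => U (i - 1), fun i => hU _,
    hI.precomp sub_left_injective, fun i j hij => hne _ _ (sub_left_injective.ne hij), fun i => ?_⟩
  have := hp (i - 1)
  simpa using this

lemma integral_two_diracs {a b p q : ℝ} (hp : 0 ≤ p) (hq : 0 ≤ q) (f : ℝ → ℝ) :
    ∫ t, f t ∂(ENNReal.ofReal p • Measure.dirac a + ENNReal.ofReal q • Measure.dirac b) =
      p * f a + q * f b := by
  have hi : ∀ (c d : ℝ), Integrable f (ENNReal.ofReal c • Measure.dirac d) := fun c d =>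
    (integrable_dirac (by simp)).smul_measure ENNReal.ofReal_ne_top
  rw [integral_add_measure (hi p a) (hi q b), integral_smul_measure, integral_smul_measure,
    integral_dirac, integral_dirac, ENNReal.toReal_ofReal hp, ENNReal.toReal_ofReal hq,
    smul_eq_mul, smul_eq_mul]

lemma measureReal_ofReal_smul_add {μ ν : Measure ℝ} [IsFiniteMeasure μ] [IsFiniteMeasure ν]
    {p q : ℝ} (hp : 0 ≤ p) (hq : 0 ≤ q) (s : Set ℝ) :
    (ENNReal.ofReal p • μ + ENNReal.ofReal q • ν).real s = p * μ.real s + q * ν.real s := by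
  have : IsFiniteMeasure (ENNReal.ofReal p • μ) := μ.smul_finite ENNReal.ofReal_ne_top
  have : IsFiniteMeasure (ENNReal.ofReal q • ν) := ν.smul_finite ENNReal.ofReal_ne_top
  rw [measureReal_add_apply, measureReal_ennreal_smul_apply, measureReal_ennreal_smul_apply,
    ENNReal.toReal_ofReal hp, ENNReal.toReal_ofReal hq]

lemma measureReal_dirac_apply {s : Set ℝ} (hs : MeasurableSet s) (a : ℝ) :
    (Measure.dirac a).real s = s.indicator 1 a := by
  rw [← integral_indicator_one hs, integral_dirac]

/-- The third variable is `0`, so `y` and `z` fix only the signs of the other two. The parameter `α`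
is the chance that the second variable takes the larger of its two values of given sign; it moves
`x` linearly from `(1 - y)(1 - z)` to `1 - yz`. -/
lemma isCyclicTuple_of_constant {x y z : ℝ} (hx : x ∈ Set.Icc (0 : ℝ) 1)
    (hy : y ∈ Set.Icc (0 : ℝ) 1) (hz : z ∈ Set.Icc (0 : ℝ) 1) (h1 : x + y * z ≤ 1)
    (h2 : (1 - y) * (1 - z) ≤ x) : IsCyclicTuple ![x, y, z] := by
  have hy' : 0 ≤ 1 - y := sub_nonneg.2 hy.2
  have hz' : 0 ≤ 1 - z := sub_nonneg.2 hz.2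
  obtain ⟨α, hα0, hα1, hα⟩ : ∃ α : ℝ, 0 ≤ α ∧ 0 ≤ 1 - α ∧
      x = (1 - y) * (1 - z) + α * (z * (1 - y) + (1 - z) * y) := by
    have hD : 0 ≤ z * (1 - y) + (1 - z) * y :=
      add_nonneg (mul_nonneg hz.1 hy') (mul_nonneg hz' hy.1)
    rcases hD.eq_or_lt with h | h
    · exact ⟨0, le_rfl, by norm_num, by linarith⟩
    · refine ⟨(x - (1 - y) * (1 - z)) / (z * (1 - y) + (1 - z) * y),
        div_nonneg (by linarith) hD, ?_, ?_⟩
      · rw [sub_nonneg, div_le_one h]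
        linarith
      · rw [div_mul_cancel₀ _ h.ne']
        ring
  -- Only the interlacing `-3 < -2 < -1 < 0 < 1 < 2 < 3` matters.
  let μ : Fin 3 → Measure ℝ := ![
    ENNReal.ofReal z • Measure.dirac 2 + ENNReal.ofReal (1 - z) • Measure.dirac (-2),
    ENNReal.ofReal (1 - y) •
        (ENNReal.ofReal α • Measure.dirac 3 + ENNReal.ofReal (1 - α) • Measure.dirac 1) +
      ENNReal.ofReal y •
        (ENNReal.ofReal α • Measure.dirac (-1) + ENNReal.ofReal (1 - α) • Measure.dirac (-3)),
    Measure.dirac 0]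
  have hsum : ∀ p : ℝ, 0 ≤ p → 0 ≤ 1 - p → ENNReal.ofReal p + ENNReal.ofReal (1 - p) = 1 := by
    intro p hp hp'
    rw [← ENNReal.ofReal_add hp hp', add_sub_cancel, ENNReal.ofReal_one]
  have hμ : ∀ i, IsProbabilityMeasure (μ i) := by
    intro i
    fin_cases i
    · exact ⟨by simp [μ, hsum z hz.1 hz']⟩
    · exact ⟨by simp [μ, ← mul_add, hsum α hα0 hα1, add_comm (ENNReal.ofReal (1 - y)),
        hsum y hy.1 hy']⟩
    · exact ⟨by simp [μ]⟩
  have hlaw : ∀ i, (Measure.pi μ).map (fun ω : Fin 3 → ℝ => ω i) = μ i := fun i =>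
    (measurePreserving_eval μ i).map_eq
  have hI : iIndepFun (fun i (ω : Fin 3 → ℝ) => ω i) (Measure.pi μ) :=
    iIndepFun_pi (X := fun _ => id) fun _ => aemeasurable_id
  have hsupp : ∀ᵐ ω ∂(Measure.pi μ), (ω 0 = 2 ∨ ω 0 = -2) ∧
      (ω 1 = 3 ∨ ω 1 = 1 ∨ ω 1 = -1 ∨ ω 1 = -3) ∧ ω 2 = 0 := by
    have e0 : ∀ᵐ t ∂(μ 0), t = 2 ∨ t = -2 := by
      rw [ae_iff]
      simp [μ]
    have e1 : ∀ᵐ t ∂(μ 1), t = 3 ∨ t = 1 ∨ t = -1 ∨ t = -3 := by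
      rw [ae_iff]
      simp [μ]
    have e2 : ∀ᵐ t ∂(μ 2), t = 0 := by
      rw [ae_iff]
      simp [μ]
    filter_upwards [(measurePreserving_eval μ 0).quasiMeasurePreserving.ae e0,
      (measurePreserving_eval μ 1).quasiMeasurePreserving.ae e1,
      (measurePreserving_eval μ 2).quasiMeasurePreserving.ae e2] with ω h0 h1 h2
    exact ⟨h0, h1, h2⟩
  refine ⟨?_, Fin 3 → ℝ, _, Measure.pi μ, inferInstance, fun i ω => ω i, fun i =>
    measurable_pi_apply i, hI, ?_, ?_⟩
  · intro i
    fin_cases i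
    exacts [hx, hy, hz]
  · intro i j hij
    have : ∀ᵐ ω ∂(Measure.pi μ), ω i ≠ ω j := by
      filter_upwards [hsupp] with ω hω
      obtain ⟨h0, h1, h2⟩ := hω
      fin_cases i <;> fin_cases j <;> simp only [ne_eq, not_true_eq_false] at hij <;>
        dsimp only [Fin.zero_eta, Fin.mk_one, Fin.reduceFinMk] <;>
        rcases h0 with h0 | h0 <;> rcases h1 with h1 | h1 | h1 | h1 <;>
        simp only [h0, h1, h2] <;> norm_num
    simpa [ae_iff] using this
  · intro i
    have h01 := measureReal_lt_eq_integral_Ioi (measurable_pi_apply 0) (measurable_pi_apply 1)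
      (hI.indepFun (show (0 : Fin 3) ≠ 1 by decide))
    have h12 := measureReal_lt_eq_integral_Iio (measurable_pi_apply 1) (measurable_pi_apply 2)
      (hI.indepFun (show (1 : Fin 3) ≠ 2 by decide))
    have h20 := measureReal_lt_eq_integral_Ioi (measurable_pi_apply 2) (measurable_pi_apply 0)
      (hI.indepFun (show (2 : Fin 3) ≠ 0 by decide))
    rw [hlaw, hlaw] at h01 h12 h20
    have r1 : ∀ s : Set ℝ, MeasurableSet s → (μ 1).real s =
        (1 - y) * (α * s.indicator 1 3 + (1 - α) * s.indicator 1 1) +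
        y * (α * s.indicator 1 (-1) + (1 - α) * s.indicator 1 (-3)) := by
      intro s hs
      have f1 := Measure.smul_finite (Measure.dirac (3 : ℝ)) (ENNReal.ofReal_ne_top (r := α))
      have f2 := Measure.smul_finite (Measure.dirac (1 : ℝ)) (ENNReal.ofReal_ne_top (r := 1 - α))
      have f3 := Measure.smul_finite (Measure.dirac (-1 : ℝ)) (ENNReal.ofReal_ne_top (r := α))
      have f4 := Measure.smul_finite (Measure.dirac (-3 : ℝ)) (ENNReal.ofReal_ne_top (r := 1 - α))
      change (ENNReal.ofReal (1 - y) • _ + ENNReal.ofReal y • _ : Measure ℝ).real s = _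
      rw [measureReal_ofReal_smul_add hy' hy.1, measureReal_ofReal_smul_add hα0 hα1,
        measureReal_ofReal_smul_add hα0 hα1]
      simp only [measureReal_dirac_apply hs]
    fin_cases i
    · refine h01.trans ?_
      change ∫ t, (μ 1).real (Set.Ioi t) ∂(ENNReal.ofReal z • Measure.dirac 2 +
        ENNReal.ofReal (1 - z) • Measure.dirac (-2)) = x
      rw [integral_two_diracs hz.1 hz', r1 _ measurableSet_Ioi, r1 _ measurableSet_Ioi, hα]
      norm_num [Set.indicator_apply]
      ring
    · refine h12.trans ?_
      change ∫ t, (μ 1).real (Set.Iio t) ∂(Measure.dirac 0) = y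
      rw [integral_dirac, r1 _ measurableSet_Iio]
      norm_num [Set.indicator_apply]
    · refine h20.trans ?_
      change ∫ t : ℝ, (ENNReal.ofReal z • Measure.dirac 2 +
        ENNReal.ofReal (1 - z) • Measure.dirac (-2) : Measure ℝ).real (Set.Ioi t)
          ∂(Measure.dirac (0 : ℝ)) = z
      rw [integral_dirac, measureReal_ofReal_smul_add hz.1 hz',
        measureReal_dirac_apply measurableSet_Ioi, measureReal_dirac_apply measurableSet_Ioi]
      norm_num [Set.indicator_apply]

/-- The construction with a constant needs an upper and a lower bound on one coordinate. If the
lower bound fails at one coordinate, the upper bounds hold at the other two (`key`). All upper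
bounds fail only for excessive `x`, all lower bounds only for excessive `1 - x`. -/
lemma isCyclicTuple_iff (x : Fin 3 → ℝ) : IsCyclicTuple x ↔
    (∀ i, x i ∈ Set.Icc (0 : ℝ) 1) ∧ ¬ Excessive (x 0) (x 1) (x 2) ∧
      ¬ Excessive (1 - x 0) (1 - x 1) (1 - x 2) := by
  refine ⟨fun h => ⟨h.1, h.not_excessive⟩, ?_⟩
  rintro ⟨hx, h1, h2⟩
  have h0' := hx 0
  have h1' := hx 1
  have h2' := hx 2
  have main : ∀ y : Fin 3 → ℝ, (∀ i, y i ∈ Set.Icc (0 : ℝ) 1) → y 0 + y 1 * y 2 ≤ 1 →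
      (1 - y 1) * (1 - y 2) ≤ y 0 → IsCyclicTuple y := by
    intro y hy ha hb
    have := isCyclicTuple_of_constant (hy 0) (hy 1) (hy 2) ha hb
    convert this using 1
    ext i
    fin_cases i <;> rfl
  have c0 := main x hx
  have c1 : x 1 + x 2 * x 0 ≤ 1 → (1 - x 2) * (1 - x 0) ≤ x 1 → IsCyclicTuple x := fun ha hb =>
    .of_shift (main (fun i => x (i + 1)) (fun i => hx _) ha hb)
  have c2 : x 2 + x 0 * x 1 ≤ 1 → (1 - x 0) * (1 - x 1) ≤ x 2 → IsCyclicTuple x := fun ha hb =>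
    .of_shift (.of_shift (main (fun i => x (i + 1 + 1)) (fun i => hx _) ha hb))
  have key : ∀ {a b c : ℝ}, a ∈ Set.Icc (0 : ℝ) 1 → b ∈ Set.Icc (0 : ℝ) 1 → c ∈ Set.Icc (0 : ℝ) 1 →
      a < (1 - b) * (1 - c) → b + c * a ≤ 1 ∧ c + a * b ≤ 1 := by
    rintro a b c ⟨ha0, ha1⟩ ⟨hb0, hb1⟩ ⟨hc0, hc1⟩ h
    have e1 : (1 - b) * (1 - c) ≤ 1 - b := mul_le_of_le_one_right (by linarith) (by linarith)
    have e2 : (1 - b) * (1 - c) ≤ 1 - c := mul_le_of_le_one_left (by linarith) (by linarith)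
    have e3 : c * a ≤ a := mul_le_of_le_one_left ha0 hc1
    have e4 : a * b ≤ a := mul_le_of_le_one_right ha0 hb1
    constructor <;> linarith
  by_cases b0 : (1 - x 1) * (1 - x 2) ≤ x 0
  · by_cases b1 : (1 - x 2) * (1 - x 0) ≤ x 1
    · by_cases b2 : (1 - x 0) * (1 - x 1) ≤ x 2
      · by_contra hc
        refine h1 ⟨?_, ?_, ?_⟩ <;> by_contra! h
        · exact hc (c0 h b0)
        · exact hc (c1 (by linarith) b1)
        · exact hc (c2 h b2)
      · exact c0 (key h2' h0' h1' (not_le.1 b2)).1 b0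
    · exact c0 (key h1' h2' h0' (not_le.1 b1)).2 b0
  · obtain ⟨a1, a2⟩ := key h0' h1' h2' (not_le.1 b0)
    by_cases b1 : (1 - x 2) * (1 - x 0) ≤ x 1
    · exact c1 a1 b1
    · refine c2 a2 ?_
      by_contra! b2
      exact h2 ⟨by linarith, by linarith, by linarith⟩

/-! ### Volumes as iterated integrals -/

lemma volume_fin_three_eq_lintegral {s : Set (Fin 3 → ℝ)} (hs : MeasurableSet s) :
    volume s = ∫⁻ v : ℝ, volume {p : ℝ × ℝ | ![v, p.1, p.2] ∈ s} := by
  let e : (Fin 3 → ℝ) ≃ᵐ ℝ × ℝ × ℝ :=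
    (MeasurableEquiv.piFinSuccAbove (fun _ => ℝ) 0).trans
      ((MeasurableEquiv.refl ℝ).prodCongr MeasurableEquiv.finTwoArrow)
  have he : MeasurePreserving e volume volume :=
    (((MeasurePreserving.id (volume : Measure ℝ)).prod
      (volume_preserving_finTwoArrow ℝ))).comp (volume_preserving_piFinSuccAbove (fun _ => ℝ) 0)
  have hsymm : ∀ q : ℝ × ℝ × ℝ, e.symm q = ![q.1, q.2.1, q.2.2] := by
    intro q
    rw [MeasurableEquiv.symm_apply_eq]
    rfl
  rw [← he.symm.measure_preimage hs.nullMeasurableSet, Measure.volume_eq_prod,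
    Measure.prod_apply (e.symm.measurable hs)]
  simp only [Set.preimage, Set.mem_ofPred_eq, hsymm]

/-- The volume of a solid over the plane region `c < x 0 < d`, `l (x 0) < x 1 < m (x 0)`. -/
lemma measureReal_solid {s : Set (Fin 3 → ℝ)} (hs : MeasurableSet s) {c d : ℝ} (hcd : c ≤ d)
    {l m A : ℝ → ℝ} {f g : ℝ → ℝ → ℝ} (hf : ∀ v, Continuous (f v)) (hg : ∀ v, Continuous (g v))
    (hmem : ∀ x, x ∈ s ↔ (c < x 0 ∧ x 0 < d) ∧ (l (x 0) < x 1 ∧ x 1 < m (x 0)) ∧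
      f (x 0) (x 1) < x 2 ∧ x 2 < g (x 0) (x 1))
    (hlm : ∀ v, c < v → v < d → l v ≤ m v)
    (hfg : ∀ v, c < v → v < d → ∀ u, l v < u → u < m v → f v u ≤ g v u)
    (hA : ∀ v, c < v → v < d → ∫ u in l v..m v, (g v u - f v u) = A v)
    (hAi : IntervalIntegrable A volume c d) :
    volume.real s = ∫ v in c..d, A v := by
  have hA0 : ∀ v ∈ Set.Ioo c d, 0 ≤ A v := by
    intro v hv
    rw [← hA v hv.1 hv.2]
    exact intervalIntegral.integral_nonneg_of_ae_restrict (hlm v hv.1 hv.2) (by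
      rw [← restrict_Ioo_eq_restrict_Icc]
      filter_upwards [ae_restrict_mem measurableSet_Ioo] with u hu
      exact sub_nonneg.2 (hfg v hv.1 hv.2 u hu.1 hu.2))
  have hslice : ∀ v : ℝ, volume {p : ℝ × ℝ | ![v, p.1, p.2] ∈ s} =
      (Set.Ioo c d).indicator (fun v => ENNReal.ofReal (A v)) v := by
    intro v
    by_cases hv : v ∈ Set.Ioo c d
    · rw [Set.indicator_of_mem hv, ← hA v hv.1 hv.2,
        intervalIntegral.integral_of_le (hlm v hv.1 hv.2), integral_Ioc_eq_integral_Ioo]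
      have hset : {p : ℝ × ℝ | ![v, p.1, p.2] ∈ s} =
          regionBetween (f v) (g v) (Set.Ioo (l v) (m v)) := by
        ext p
        rw [Set.mem_ofPred_eq, hmem]
        simp only [regionBetween, Set.mem_ofPred_eq, Set.mem_Ioo]
        exact ⟨fun h => h.2, fun h => ⟨hv, h⟩⟩
      have hint : ∀ k : ℝ → ℝ, Continuous k → IntegrableOn k (Set.Ioo (l v) (m v)) := fun k hk =>
        (hk.continuousOn.integrableOn_compact isCompact_Icc).mono_set Set.Ioo_subset_Icc_self
      rw [hset, Measure.volume_eq_prod, volume_regionBetween_eq_integral (hint _ (hf v))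
        (hint _ (hg v)) measurableSet_Ioo fun u hu => hfg v hv.1 hv.2 u hu.1 hu.2]
      rfl
    · rw [Set.indicator_of_notMem hv]
      convert measure_empty (μ := (volume : Measure (ℝ × ℝ)))
      ext p
      rw [Set.mem_ofPred_eq, hmem]
      simp only [Set.mem_empty_iff_false, iff_false]
      exact fun h => hv h.1
  rw [measureReal_def, volume_fin_three_eq_lintegral hs, lintegral_congr hslice,
    lintegral_indicator measurableSet_Ioo, ← ofReal_integral_eq_lintegral_ofReal,
    intervalIntegral.integral_of_le hcd, integral_Ioc_eq_integral_Ioo, ENNReal.toReal_ofReal]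
  · exact setIntegral_nonneg measurableSet_Ioo hA0
  · exact ((intervalIntegrable_iff_integrableOn_Ioc_of_le hcd).1 hAi).mono_set
      Set.Ioo_subset_Ioc_self
  · filter_upwards [ae_restrict_mem measurableSet_Ioo] with v hv using hA0 v hv

lemma integral_bilinear_sub_one {k a b : ℝ} :
    ∫ u in a..b, (k * u - 1) = k * (b ^ 2 - a ^ 2) / 2 - (b - a) := by
  rw [intervalIntegral.integral_sub (Continuous.intervalIntegrable (by fun_prop) _ _)
    (Continuous.intervalIntegrable (by fun_prop) _ _), intervalIntegral.integral_const_mul,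
    integral_id, intervalIntegral.integral_const]
  simp
  ring

lemma measureReal_comp_perm (σ : Equiv.Perm (Fin 3)) {s : Set (Fin 3 → ℝ)}
    (hs : MeasurableSet s) : volume.real {x | x ∘ σ ∈ s} = volume.real s := by
  have h := volume_measurePreserving_piCongrLeft (fun _ : Fin 3 => ℝ) σ.symm
  have h2 := h.measure_preimage hs.nullMeasurableSet
  rw [measureReal_def, measureReal_def, ← h2]
  congr 2
  ext x
  have : MeasurableEquiv.piCongrLeft (fun _ : Fin 3 => ℝ) σ.symm x = x ∘ σ := by
    ext i
    simp [MeasurableEquiv.coe_piCongrLeft, Equiv.piCongrLeft_apply]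
  rw [Set.mem_preimage, this]
  rfl

/-- The ordered triples in the open cube that are excessive. -/
def orderedExcessive : Set (Fin 3 → ℝ) :=
  {x | 0 < x 0 ∧ x 0 < x 1 ∧ x 1 < x 2 ∧ x 2 < 1 ∧ 1 < x 0 + x 1 * x 2}

lemma measurableSet_orderedExcessive : MeasurableSet orderedExcessive := by
  unfold orderedExcessive
  simp only [Set.ofPred_and]
  refine .inter ?_ (.inter ?_ (.inter ?_ (.inter ?_ ?_))) <;>
    exact measurableSet_lt (by fun_prop) (by fun_prop)

lemma sqrt_five_bounds : (2.23606797 : ℝ) < √5 ∧ √5 < 2.23606798 :=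
  ⟨Real.lt_sqrt_of_sq_lt (by norm_num), (Real.sqrt_lt' (by norm_num)).2 (by norm_num)⟩

lemma measureReal_orderedExcessive :
    volume.real orderedExcessive =
      (21 / 8 - 11 * √5 / 8 + 3 * Real.log (√5 - 1)) / 6 := by
  have h5 : √5 ^ 2 = 5 := Real.sq_sqrt (by norm_num)
  obtain ⟨hl, hr⟩ := sqrt_five_bounds
  -- The positive root of `v (1 + v) = 1`: a largest coordinate `v` leaves room for a middle one in
  -- `(1 / (1 + v), v)` only if `v > c`.
  set c := (√5 - 1) / 2 with hc
  have hc2 : c ^ 2 + c = 1 := by rw [hc]; linear_combination h5 / 4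
  have hc0 : 0 < c := by rw [hc]; linarith
  have hc1 : c < 1 := by rw [hc]; linarith
  -- Reversal makes the largest coordinate the outermost variable.
  rw [← measureReal_comp_perm Fin.revPerm measurableSet_orderedExcessive]
  have hm : MeasurableSet {x : Fin 3 → ℝ | x ∘ Fin.revPerm ∈ orderedExcessive} :=
    measurableSet_orderedExcessive.preimage (measurable_pi_lambda _ fun i => measurable_pi_apply _)
  have key : ∀ v, c < v → 0 < 1 + v ∧ 1 < v * (1 + v) := by
    intro v hv
    constructor <;> nlinarith
  have hAi : IntervalIntegrable (fun v => 1 / 2 * (v ^ 3 + v ^ 2 - 2 * v + (1 + v)⁻¹))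
      volume c 1 := by
    refine ContinuousOn.intervalIntegrable ?_
    rw [Set.uIcc_of_le hc1.le]
    have : ∀ v ∈ Set.Icc c 1, 1 + v ≠ 0 := fun v hv => by linarith [hv.1]
    fun_prop (disch := assumption)
  rw [measureReal_solid hm hc1.le (l := fun v => 1 / (1 + v)) (m := fun v => v)
    (f := fun v u => 1 - v * u) (g := fun _ u => u)
    (A := fun v => 1 / 2 * (v ^ 3 + v ^ 2 - 2 * v + (1 + v)⁻¹))]
  · rw [intervalIntegral.integral_eq_sub_of_hasDerivAt
      (f := fun v => 1 / 2 * (v ^ 4 / 4 + v ^ 3 / 3 - v ^ 2 + Real.log (1 + v)))]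
    · have e1 : Real.log (1 + 1) - Real.log (1 + c) = Real.log (√5 - 1) := by
        rw [← Real.log_div (by norm_num) (by linarith)]
        congr 1
        rw [div_eq_iff (by linarith)]
        linear_combination (-2) * hc2 - (1 + c) * (2 * hc)
      have e2 : c ^ 3 = 2 * c - 1 := by linear_combination (c - 1) * hc2
      have e3 : c ^ 4 = 2 - 3 * c := by linear_combination (c ^ 2 - c + 2) * hc2
      have e4 : c ^ 2 = 1 - c := by linear_combination hc2
      have e5 : √5 = 2 * c + 1 := by rw [hc]; ring
      rw [e2, e3, e4, ← e1, e5]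
      ring
    · intro v hv
      rw [Set.uIcc_of_le hc1.le] at hv
      have h1 : HasDerivAt (fun v : ℝ => 1 + v) 1 v := (hasDerivAt_id v).const_add 1
      have h2 := h1.log (by linarith [hv.1])
      have h3 := ((((hasDerivAt_pow 4 v).div_const 4).add ((hasDerivAt_pow 3 v).div_const 3)).sub
        (hasDerivAt_pow 2 v)).add h2 |>.const_mul (1 / 2)
      refine h3.congr_deriv ?_
      norm_num
    · exact hAi
  · fun_prop
  · fun_prop
  · intro x
    simp only [orderedExcessive, Set.mem_ofPred_eq, Function.comp_apply, Fin.revPerm_apply]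
    change 0 < x 2 ∧ x 2 < x 1 ∧ x 1 < x 0 ∧ x 0 < 1 ∧ 1 < x 2 + x 1 * x 0 ↔ _
    constructor
    · rintro ⟨h1, h2, h3, h4, h6⟩
      have h0 : 0 < x 0 := by linarith
      have e : 1 < x 1 * (1 + x 0) := by linarith
      have : c < x 0 := by nlinarith
      refine ⟨⟨this, h4⟩, ⟨?_, h3⟩, by linarith, h2⟩
      rw [div_lt_iff₀ (by linarith)]
      exact e
    · rintro ⟨⟨h1, h2⟩, ⟨h3, h4⟩, h6, h7⟩
      have : 0 < x 1 := lt_trans (by have := (key _ h1).1; positivity) h3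
      refine ⟨?_, h7, h4, h2, by linarith⟩
      nlinarith
  · intro v hv _
    rw [div_le_iff₀ (key v hv).1]
    exact (key v hv).2.le
  · intro v hv _ u hu _
    rw [div_lt_iff₀ (key v hv).1] at hu
    linarith
  · intro v hv _
    have := (key v hv).1
    have e : ∀ u : ℝ, u - (1 - v * u) = (1 + v) * u - 1 := fun u => by ring
    simp only [e, integral_bilinear_sub_one]
    field_simp
    ring
  · exact hAi

/-- The points of the cube with first coordinate at most `1 / 2` that are excessive. -/
def lowExcessive : Set (Fin 3 → ℝ) :=
  {x | x ∈ Set.Icc (0 : Fin 3 → ℝ) 1 ∧ x 0 ≤ 1 / 2 ∧ 1 < x 0 + x 1 * x 2}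

lemma measurableSet_lowExcessive : MeasurableSet lowExcessive := by
  unfold lowExcessive
  simp only [Set.ofPred_and]
  exact measurableSet_Icc.inter ((measurableSet_le (by fun_prop) (by fun_prop)).inter
    (measurableSet_lt (by fun_prop) (by fun_prop)))

lemma ae_apply_ne (i : Fin 3) (c : ℝ) : ∀ᵐ x : Fin 3 → ℝ, x i ≠ c := by
  rw [ae_iff]
  simp only [not_not]
  exact Measure.pi_hyperplane (fun _ : Fin 3 => (volume : Measure ℝ)) i c

lemma ae_forall_mem_Ioo_of_mem_Icc : ∀ᵐ x : Fin 3 → ℝ, x ∈ Set.Icc (0 : Fin 3 → ℝ) 1 →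
    ∀ i, 0 < x i ∧ x i < 1 := by
  filter_upwards [ae_all_iff.2 fun i => ae_apply_ne i 0,
    ae_all_iff.2 fun i => ae_apply_ne i 1] with x h0 h1 hx i
  exact ⟨(hx.1 i).lt_of_ne (h0 i).symm, (hx.2 i).lt_of_ne (h1 i)⟩

/-- Over `(x 1, x 2)` the fibre runs from `1 - x 1 * x 2` to `1 / 2`, so it has positive length
exactly when the product exceeds `1 / 2`. -/
lemma measureReal_lowExcessive : volume.real lowExcessive = -1 / 16 + Real.log 2 / 8 := by
  let s : Set (Fin 3 → ℝ) := {x | (1 / 2 < x 2 ∧ x 2 < 1) ∧ (1 / (2 * x 2) < x 1 ∧ x 1 < 1) ∧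
    1 - x 2 * x 1 < x 0 ∧ x 0 < 1 / 2}
  have hsm : MeasurableSet s := by
    have : Measurable fun x : Fin 3 → ℝ => 1 / (2 * x 2) := by fun_prop
    simp only [s, Set.ofPred_and]
    refine .inter (.inter ?_ ?_) (.inter (.inter ?_ ?_) (.inter ?_ ?_)) <;>
      exact measurableSet_lt (by fun_prop) (by fun_prop)
  have hae : volume.real lowExcessive = volume.real s := by
    apply measureReal_congr
    filter_upwards [ae_forall_mem_Ioo_of_mem_Icc, ae_apply_ne 0 (1 / 2)] with x hx hx0
    apply propext
    change (x ∈ Set.Icc (0 : Fin 3 → ℝ) 1 ∧ x 0 ≤ 1 / 2 ∧ 1 < x 0 + x 1 * x 2) ↔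
      ((1 / 2 < x 2 ∧ x 2 < 1) ∧ (1 / (2 * x 2) < x 1 ∧ x 1 < 1) ∧
        1 - x 2 * x 1 < x 0 ∧ x 0 < 1 / 2)
    constructor
    · rintro ⟨h1, h2, h3⟩
      obtain ⟨b0, b0'⟩ := hx h1 0
      obtain ⟨b1, b1'⟩ := hx h1 1
      obtain ⟨b2, b2'⟩ := hx h1 2
      refine ⟨⟨by nlinarith, b2'⟩, ⟨?_, b1'⟩, by linarith, h2.lt_of_ne hx0⟩
      rw [div_lt_iff₀ (by linarith)]
      linarith
    · rintro ⟨⟨h1, h2⟩, ⟨h3, h4⟩, h6, h7⟩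
      have b1 : 0 < x 1 := lt_trans (by positivity) h3
      have b0 : 0 < x 0 := by nlinarith
      refine ⟨⟨?_, ?_⟩, h7.le, by linarith⟩
      · intro i
        fin_cases i
        exacts [b0.le, b1.le, le_trans (by norm_num) h1.le]
      · intro i
        fin_cases i
        exacts [le_trans h7.le (by norm_num), h4.le, h2.le]
  rw [hae, ← measureReal_comp_perm Fin.revPerm hsm]
  have hm : MeasurableSet {x : Fin 3 → ℝ | x ∘ Fin.revPerm ∈ s} :=
    hsm.preimage (measurable_pi_lambda _ fun i => measurable_pi_apply _)
  have key : ∀ v : ℝ, 1 / 2 < v → 0 < 2 * v := fun v hv => by linarith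
  have hAi : IntervalIntegrable (fun v : ℝ => 1 / 2 * (v - 1 + 1 / 4 * v⁻¹))
      volume (1 / 2) 1 := by
    refine ContinuousOn.intervalIntegrable ?_
    rw [Set.uIcc_of_le (by norm_num)]
    have : ∀ v ∈ Set.Icc (1 / 2 : ℝ) 1, v ≠ 0 := fun v hv => by linarith [hv.1]
    fun_prop (disch := assumption)
  rw [measureReal_solid hm (c := 1 / 2) (d := 1) (by norm_num) (l := fun v => 1 / (2 * v))
    (m := fun _ => 1) (f := fun v u => 1 - v * u) (g := fun _ u => 1 / 2)
    (A := fun v => 1 / 2 * (v - 1 + 1 / 4 * v⁻¹))]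
  · rw [intervalIntegral.integral_eq_sub_of_hasDerivAt
      (f := fun v => 1 / 2 * (v ^ 2 / 2 - v + 1 / 4 * Real.log v))]
    · rw [one_div, Real.log_inv, Real.log_one]
      ring
    · intro v hv
      rw [Set.uIcc_of_le (by norm_num)] at hv
      have h2 := Real.hasDerivAt_log (x := v) (by linarith [hv.1])
      have h3 := (((hasDerivAt_pow 2 v).div_const 2).sub (hasDerivAt_id v)).add
        (h2.const_mul (1 / 4)) |>.const_mul (1 / 2)
      refine h3.congr_deriv ?_
      norm_num
    · exact hAi
  · fun_prop
  · fun_prop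
  · intro x
    rfl
  · intro v hv _
    rw [div_le_iff₀ (key v hv)]
    linarith
  · intro v hv _ u hu _
    rw [div_lt_iff₀ (key v hv)] at hu
    linarith
  · intro v hv _
    have := key v hv
    have hv0 : v ≠ 0 := by linarith
    have e : ∀ u : ℝ, 1 / 2 - (1 - v * u) = 1 / 2 * (2 * v * u - 1) := fun u => by ring
    simp only [e, intervalIntegral.integral_const_mul, integral_bilinear_sub_one]
    field_simp
    ring
  · exact hAi

/-! ### Volume of the excessive set -/

/-- The excessive triples in the cube. -/
def excessiveSet : Set (Fin 3 → ℝ) :=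
  {x | x ∈ Set.Icc (0 : Fin 3 → ℝ) 1 ∧ Excessive (x 0) (x 1) (x 2)}

lemma measurableSet_excessiveSet : MeasurableSet excessiveSet := by
  unfold excessiveSet Excessive
  simp only [Set.ofPred_and]
  refine measurableSet_Icc.inter (.inter ?_ (.inter ?_ ?_)) <;>
    exact measurableSet_lt (by fun_prop) (by fun_prop)

lemma excessive_iff_forall {x : Fin 3 → ℝ} : Excessive (x 0) (x 1) (x 2) ↔
    ∀ i j k, i ≠ j → j ≠ k → i ≠ k → 1 < x i + x j * x k := by
  constructor
  · rintro ⟨h0, h1, h2⟩ i j k hij hjk hik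
    fin_cases i <;> fin_cases j <;> fin_cases k <;>
      simp only [ne_eq, not_true_eq_false] at hij hjk hik <;>
      dsimp only [Fin.zero_eta, Fin.mk_one, Fin.reduceFinMk] <;> linarith
  · intro h
    exact ⟨h 0 1 2 (by decide) (by decide) (by decide), h 1 0 2 (by decide) (by decide) (by decide),
      h 2 0 1 (by decide) (by decide) (by decide)⟩

lemma excessive_comp_perm (σ : Equiv.Perm (Fin 3)) {x : Fin 3 → ℝ} :
    Excessive (x (σ 0)) (x (σ 1)) (x (σ 2)) ↔ Excessive (x 0) (x 1) (x 2) := by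
  have h := excessive_iff_forall (x := x ∘ σ)
  simp only [Function.comp_apply] at h
  rw [h, excessive_iff_forall]
  constructor
  · intro h i j k hij hjk hik
    have := h (σ.symm i) (σ.symm j) (σ.symm k) (by simpa) (by simpa) (by simpa)
    simpa using this
  · intro h i j k hij hjk hik
    exact h _ _ _ (by simpa) (by simpa) (by simpa)

lemma ae_injective : ∀ᵐ x : Fin 3 → ℝ, Function.Injective x := by
  have h : ∀ i j : Fin 3, i ≠ j → ∀ᵐ x : Fin 3 → ℝ, x i ≠ x j := by
    intro i j hij
    have := Measure.addHaar_submodule (volume : Measure (Fin 3 → ℝ))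
      (LinearMap.ker (LinearMap.proj (R := ℝ) (φ := fun _ : Fin 3 => ℝ) i - LinearMap.proj j)) (by
        intro htop
        have : Pi.single i (1 : ℝ) ∈ LinearMap.ker
            (LinearMap.proj (R := ℝ) (φ := fun _ : Fin 3 => ℝ) i - LinearMap.proj j) := by
          rw [htop]; trivial
        simp [hij.symm] at this)
    rw [ae_iff, ← this]
    congr 1
    ext x
    simp [sub_eq_zero]
  have h' : ∀ᵐ x : Fin 3 → ℝ, ∀ i j : Fin 3, i ≠ j → x i ≠ x j :=
    ae_all_iff.2 fun i => ae_all_iff.2 fun j => Filter.eventually_all.2 (h i j)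
  filter_upwards [h'] with x hx i j hij
  by_contra hne
  exact hx i j hne hij

lemma volume_unitCube : volume (Set.Icc (0 : Fin 3 → ℝ) 1) = 1 := by
  rw [Real.volume_Icc_pi]
  simp

lemma measure_ne_top_of_subset_unitCube {s : Set (Fin 3 → ℝ)}
    (h : s ⊆ Set.Icc (0 : Fin 3 → ℝ) 1) : volume s ≠ ⊤ :=
  ((measure_mono h).trans_lt (by simp [volume_unitCube])).ne

lemma mem_unitCube_comp_perm {σ : Equiv.Perm (Fin 3)} {x : Fin 3 → ℝ} :
    x ∘ σ ∈ Set.Icc (0 : Fin 3 → ℝ) 1 ↔ x ∈ Set.Icc (0 : Fin 3 → ℝ) 1 := by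
  constructor
  · intro h
    exact ⟨fun i => by simpa using h.1 (σ.symm i), fun i => by simpa using h.2 (σ.symm i)⟩
  · intro h
    exact ⟨fun i => h.1 (σ i), fun i => h.2 (σ i)⟩

lemma orderedExcessive_subset : orderedExcessive ⊆ Set.Icc (0 : Fin 3 → ℝ) 1 := by
  rintro x ⟨h0, h1, h2, h3, -⟩
  constructor <;> intro i <;> fin_cases i <;>
    simp only [Fin.zero_eta, Fin.mk_one, Fin.reduceFinMk, Pi.zero_apply, Pi.one_apply] <;> linarith

lemma measureReal_excessiveSet :
    volume.real excessiveSet = 21 / 8 - 11 * √5 / 8 + 3 * Real.log (√5 - 1) := by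
  have hmono : ∀ {y : Fin 3 → ℝ}, y ∈ orderedExcessive → StrictMono y := by
    rintro y ⟨-, h1, h2, -, -⟩
    exact Fin.strictMono_iff_lt_succ.2 fun i => by fin_cases i <;> assumption
  have hae : volume.real excessiveSet =
      volume.real (⋃ σ ∈ (Finset.univ : Finset (Equiv.Perm (Fin 3))),
        {x : Fin 3 → ℝ | x ∘ σ ∈ orderedExcessive}) := by
    apply measureReal_congr
    filter_upwards [ae_forall_mem_Ioo_of_mem_Icc, ae_injective] with x hx hinj
    apply propext
    change x ∈ excessiveSet ↔ x ∈ ⋃ σ ∈ (Finset.univ : Finset (Equiv.Perm (Fin 3))),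
        {x : Fin 3 → ℝ | x ∘ σ ∈ orderedExcessive}
    simp only [Set.mem_iUnion, Finset.mem_univ, exists_true_left, Set.mem_ofPred_eq]
    constructor
    · rintro ⟨hc, he⟩
      have hs : StrictMono (x ∘ Tuple.sort x) :=
        (Tuple.monotone_sort x).strictMono_of_injective (hinj.comp (Tuple.sort x).injective)
      refine ⟨Tuple.sort x, (hx hc _).1, hs (by decide), hs (by decide), (hx hc _).2, ?_⟩
      exact ((excessive_comp_perm (Tuple.sort x)).2 he).1
    · rintro ⟨σ, h⟩
      refine ⟨mem_unitCube_comp_perm.1 (orderedExcessive_subset h), (excessive_comp_perm σ).1 ?_⟩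
      obtain ⟨h0, h1, h2, h3, h4⟩ := h
      simp only [Function.comp_apply] at h0 h1 h2 h3 h4
      -- For sorted `a < b < c < 1` the first condition is the strongest: `(b + ac) - (a + bc) = (b
      -- - a)(1 - c)`, and similarly for `c + ab`.
      exact ⟨h4, by nlinarith, by nlinarith⟩
  have hm : ∀ σ : Equiv.Perm (Fin 3), MeasurableSet {x : Fin 3 → ℝ | x ∘ σ ∈ orderedExcessive} :=
    fun σ => measurableSet_orderedExcessive.preimage
      (measurable_pi_lambda _ fun i => measurable_pi_apply _)
  rw [hae, measureReal_biUnion_finset ?_ ?_ ?_]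
  · simp only [measureReal_comp_perm _ measurableSet_orderedExcessive,
      measureReal_orderedExcessive, Finset.sum_const, Finset.card_univ, Fintype.card_perm,
      Fintype.card_fin, nsmul_eq_mul]
    norm_num [Nat.factorial]
    ring
  · intro σ _ τ _ hne
    rw [Function.onFun, Set.disjoint_left]
    intro x hσ hτ
    apply hne
    have h1 := hmono hσ
    have h2 := hmono hτ
    have hx : Function.Injective x := by
      have := h1.injective
      rwa [σ.injective_comp] at this
    -- A strictly increasing rearrangement is determined by its range.
    have : x ∘ σ = x ∘ τ := (h1.range_inj h2).1 (by
      simp [σ.surjective.range_comp, τ.surjective.range_comp])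
    ext i
    rw [hx (congrFun this i)]
  · exact fun σ _ => hm σ
  · intro σ _
    exact measure_ne_top_of_subset_unitCube fun x hx =>
      mem_unitCube_comp_perm.1 (orderedExcessive_subset hx)

/-! ### Measure of the cyclic triples -/

/-- The central reflection of `excessiveSet`. -/
def reflectedExcessiveSet : Set (Fin 3 → ℝ) := (fun x => 1 - x) ⁻¹' excessiveSet

lemma measurableSet_reflectedExcessiveSet : MeasurableSet reflectedExcessiveSet :=
  measurableSet_excessiveSet.preimage (measurable_const.sub measurable_id)

lemma measureReal_reflectedExcessiveSet :
    volume.real reflectedExcessiveSet = volume.real excessiveSet := by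
  rw [measureReal_def, measureReal_def, reflectedExcessiveSet,
    (Measure.measurePreserving_sub_left volume (1 : Fin 3 → ℝ)).measure_preimage
      measurableSet_excessiveSet.nullMeasurableSet]

/-- Membership in both would give `1 - x 1 * x 2 < x 0 < (1 - x 1) * (1 - x 2)`, impossible in the
cube since `2 * x 1 * x 2 ≤ x 1 + x 2`. -/
lemma disjoint_excessiveSet_reflected : Disjoint excessiveSet reflectedExcessiveSet := by
  rw [Set.disjoint_left]
  rintro x ⟨⟨h0, h1⟩, h, -⟩ ⟨-, h', -⟩
  have a1 : 0 ≤ x 1 := h0 1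
  have a2 : 0 ≤ x 2 := h0 2
  have b1 : x 1 ≤ 1 := h1 1
  have b2 : x 2 ≤ 1 := h1 2
  simp only [Pi.sub_apply, Pi.one_apply] at h'
  nlinarith

lemma setOf_isCyclicTuple : {x : Fin 3 → ℝ | IsCyclicTuple x} =
    Set.Icc (0 : Fin 3 → ℝ) 1 \ (excessiveSet ∪ reflectedExcessiveSet) := by
  ext x
  have hIcc : (∀ i, x i ∈ Set.Icc (0 : ℝ) 1) ↔ x ∈ Set.Icc (0 : Fin 3 → ℝ) 1 :=
    ⟨fun h => ⟨fun i => (h i).1, fun i => (h i).2⟩, fun h i => ⟨h.1 i, h.2 i⟩⟩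
  have hIcc' : x ∈ Set.Icc (0 : Fin 3 → ℝ) 1 → 1 - x ∈ Set.Icc (0 : Fin 3 → ℝ) 1 :=
    fun h => ⟨sub_nonneg.2 h.2, sub_le_self _ h.1⟩
  rw [Set.mem_ofPred_eq, isCyclicTuple_iff, hIcc]
  change _ ↔ x ∈ Set.Icc (0 : Fin 3 → ℝ) 1 ∧ ¬ ((x ∈ Set.Icc (0 : Fin 3 → ℝ) 1 ∧
    Excessive (x 0) (x 1) (x 2)) ∨ (1 - x ∈ Set.Icc (0 : Fin 3 → ℝ) 1 ∧
    Excessive (1 - x 0) (1 - x 1) (1 - x 2)))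
  tauto

lemma measurableSet_isCyclicTuple : MeasurableSet {x : Fin 3 → ℝ | IsCyclicTuple x} := by
  rw [setOf_isCyclicTuple]
  exact measurableSet_Icc.diff
    (measurableSet_excessiveSet.union measurableSet_reflectedExcessiveSet)

lemma excessiveSet_subset : excessiveSet ⊆ Set.Icc (0 : Fin 3 → ℝ) 1 := fun _ h => h.1

lemma reflectedExcessiveSet_subset : reflectedExcessiveSet ⊆ Set.Icc (0 : Fin 3 → ℝ) 1 :=
  fun x h => ⟨by simpa using h.1.2, by simpa using h.1.1⟩

lemma measureReal_isCyclicTuple : volume.real {x : Fin 3 → ℝ | IsCyclicTuple x} = pThree := by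
  rw [setOf_isCyclicTuple, measureReal_sdiff
    (Set.union_subset excessiveSet_subset reflectedExcessiveSet_subset)
    (measurableSet_excessiveSet.union measurableSet_reflectedExcessiveSet)
    (measure_ne_top_of_subset_unitCube subset_rfl),
    measureReal_union disjoint_excessiveSet_reflected measurableSet_reflectedExcessiveSet
      (measure_ne_top_of_subset_unitCube excessiveSet_subset)
      (measure_ne_top_of_subset_unitCube reflectedExcessiveSet_subset),
    measureReal_reflectedExcessiveSet, measureReal_excessiveSet, measureReal_def, volume_unitCube,
    pThree, ENNReal.toReal_one]
  ring

/-! ### Measure of the nontransitive triples -/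

/-- The part of the cube where every coordinate exceeds `1 / 2`. -/
def upperOctant : Set (Fin 3 → ℝ) := Set.pi Set.univ fun _ => Set.Ioc (1 / 2 : ℝ) 1

lemma measurableSet_upperOctant : MeasurableSet upperOctant :=
  .univ_pi fun _ => measurableSet_Ioc

lemma measureReal_upperOctant : volume.real upperOctant = 1 / 8 := by
  rw [measureReal_def, upperOctant, volume_pi_pi]
  simp only [Real.volume_Ioc, Finset.prod_const, Finset.card_univ, Fintype.card_fin,
    ENNReal.toReal_pow]
  rw [ENNReal.toReal_ofReal] <;> norm_num

lemma upperOctant_subset : upperOctant ⊆ Set.Icc (0 : Fin 3 → ℝ) 1 := fun x h =>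
  ⟨fun i => le_trans (by norm_num) (h i trivial).1.le, fun i => (h i trivial).2⟩

lemma setOf_isNontransitiveTuple : {x : Fin 3 → ℝ | IsNontransitiveTuple x} =
    upperOctant \ excessiveSet := by
  have h : {x : Fin 3 → ℝ | IsNontransitiveTuple x} =
      {x | IsCyclicTuple x} ∩ {x | ∀ i, x i > 1 / 2} := rfl
  rw [h, setOf_isCyclicTuple]
  ext x
  constructor
  · rintro ⟨⟨h1, h2⟩, h3⟩
    exact ⟨fun i _ => ⟨h3 i, h1.2 i⟩, fun h => h2 (Or.inl h)⟩
  · rintro ⟨h1, h2⟩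
    refine ⟨⟨upperOctant_subset h1, ?_⟩, fun i => (h1 i trivial).1⟩
    rintro (h | ⟨-, h, -⟩)
    · exact h2 h
    -- Reflected excess would give `x 0 < (1 - x 1) * (1 - x 2) < 1 / 4`.
    · have a0 := (h1 0 trivial).1
      have a1 := (h1 1 trivial).1
      have a2 := (h1 2 trivial).1
      have b2 := (h1 2 trivial).2
      simp only [Pi.sub_apply, Pi.one_apply] at h
      nlinarith

lemma measurableSet_isNontransitiveTuple :
    MeasurableSet {x : Fin 3 → ℝ | IsNontransitiveTuple x} := by
  rw [setOf_isNontransitiveTuple]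
  exact measurableSet_upperOctant.diff measurableSet_excessiveSet

/-- From `bc > 1 - a` one gets `c (b + ac - 1) > (1 - c)(1 - a(1 + c))`, which is nonnegative
because `a ≤ 1/2`. -/
lemma excessive_of_le_half {a b c : ℝ} (ha0 : 0 ≤ a) (ha : a ≤ 1 / 2) (hb0 : 0 ≤ b) (hb : b ≤ 1)
    (hc0 : 0 ≤ c) (hc : c ≤ 1) (h : 1 < a + b * c) : Excessive a b c := by
  have aux : ∀ {b c : ℝ}, 0 ≤ b → b ≤ 1 → 0 ≤ c → c ≤ 1 → 1 < a + b * c → 1 < b + a * c := by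
    intro b c hb0 hb hc0 hc h
    have hc' : 0 < c := hc0.lt_of_ne (by rintro rfl; linarith)
    have e : 0 ≤ (1 - c) * (1 - a * (1 + c)) := mul_nonneg (by linarith) (by nlinarith)
    have : 0 < c * (b + a * c - 1) := by nlinarith
    linarith [pos_of_mul_pos_right this hc0]
  exact ⟨h, aux hb0 hb hc0 hc h, aux hc0 hc hb0 hb (by linarith)⟩

/-- The pieces are indexed by the coordinate that is `≤ 1/2`. Two such coordinates would give `x i +
x j * x k ≤ 1/2 + 1/2`, so the pieces are disjoint. -/
lemma measureReal_excessiveSet_diff_upperOctant :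
    volume.real (excessiveSet \ upperOctant) = 3 * (-1 / 16 + Real.log 2 / 8) := by
  have hset : excessiveSet \ upperOctant = ⋃ i ∈ (Finset.univ : Finset (Fin 3)),
      {x : Fin 3 → ℝ | x ∘ Equiv.addRight i ∈ lowExcessive} := by
    ext x
    simp only [Set.mem_iUnion, Finset.mem_univ, exists_true_left, Set.mem_ofPred_eq]
    constructor
    · rintro ⟨⟨hc, he⟩, hu⟩
      have : ∃ i, x i ≤ 1 / 2 := by
        by_contra! hi
        exact hu fun i _ => ⟨hi i, hc.2 i⟩
      obtain ⟨i, hi⟩ := this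
      refine ⟨i, mem_unitCube_comp_perm.2 hc, by simpa using hi, ?_⟩
      exact ((excessive_comp_perm (Equiv.addRight i)).2 he).1
    · rintro ⟨i, hc, hi, he⟩
      have hex := excessive_of_le_half (hc.1 0) hi (hc.1 1) (hc.2 1) (hc.1 2) (hc.2 2) he
      refine ⟨⟨mem_unitCube_comp_perm.1 hc, (excessive_comp_perm (Equiv.addRight i)).1 hex⟩, ?_⟩
      intro hu
      have := (hu i trivial).1
      simp only [Function.comp_apply, Equiv.coe_addRight, zero_add] at hi
      linarith
  rw [hset, measureReal_biUnion_finset ?_ ?_ ?_]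
  · simp only [measureReal_comp_perm _ measurableSet_lowExcessive, measureReal_lowExcessive,
      Finset.sum_const, Finset.card_univ, Fintype.card_fin, nsmul_eq_mul]
    norm_num
  · intro i _ j _ hne
    rw [Function.onFun, Set.disjoint_left]
    rintro x ⟨hc, hi, he⟩ ⟨-, hj, -⟩
    simp only [Function.comp_apply, Equiv.coe_addRight, zero_add] at hi hj he
    have hc' : ∀ k, 0 ≤ x k ∧ x k ≤ 1 := fun k =>
      ⟨(mem_unitCube_comp_perm.1 hc).1 k, (mem_unitCube_comp_perm.1 hc).2 k⟩
    have hjk : j = 1 + i ∨ j = 2 + i := by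
      revert hne; clear * -
      revert i j; decide
    have a := hc' (1 + i)
    have b := hc' (2 + i)
    rcases hjk with rfl | rfl <;> nlinarith
  · exact fun i _ => measurableSet_lowExcessive.preimage
      (measurable_pi_lambda _ fun i => measurable_pi_apply _)
  · intro i _
    exact measure_ne_top_of_subset_unitCube fun x hx => mem_unitCube_comp_perm.1 hx.1

lemma measureReal_isNontransitiveTuple :
    volume.real {x : Fin 3 → ℝ | IsNontransitiveTuple x} = pThreeStar := by
  have h1 := measureReal_sdiff_add_inter (μ := volume) (s := upperOctant)
    measurableSet_excessiveSet (measure_ne_top_of_subset_unitCube upperOctant_subset)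
  have h2 := measureReal_sdiff_add_inter (μ := volume) (s := excessiveSet)
    measurableSet_upperOctant (measure_ne_top_of_subset_unitCube excessiveSet_subset)
  rw [Set.inter_comm, measureReal_excessiveSet_diff_upperOctant, measureReal_excessiveSet] at h2
  rw [measureReal_upperOctant] at h1
  rw [setOf_isNontransitiveTuple, pThreeStar]
  linarith

/-! ### Numerical bounds and conclusion -/

lemma log_sqrt_five_sub_one_bounds :
    0.21193534 < Real.log (√5 - 1) ∧ Real.log (√5 - 1) < 0.2119354 := by
  obtain ⟨s1, s2⟩ := sqrt_five_bounds
  constructor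
  -- `√5 - 1 = (1 - q)⁻¹` with `q = (3 - √5) / 4 ≈ 0.190983006`; twelve terms of the series of `log
  -- (1 - q)` suffice.
  · have h := (abs_le.1 (Real.abs_log_sub_add_sum_range_le (x := 0.190983) (by norm_num [abs_lt])
      12)).2
    have hle : Real.log (1 - 0.190983)⁻¹ ≤ Real.log (√5 - 1) :=
      Real.log_le_log (by norm_num) (by norm_num at *; linarith)
    rw [Real.log_inv] at hle
    norm_num [Finset.sum_range_succ, abs_of_pos] at h hle ⊢
    linarith
  · have h := (abs_le.1 (Real.abs_log_sub_add_sum_range_le (x := 0.19098301)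
      (by norm_num [abs_lt]) 12)).1
    have hle : Real.log (√5 - 1) ≤ Real.log (1 - 0.19098301)⁻¹ :=
      Real.log_le_log (by linarith) (by norm_num at *; linarith)
    rw [Real.log_inv] at hle
    norm_num [Finset.sum_range_succ, abs_of_pos] at h hle ⊢
    linarith

lemma measureReal_preimage_of_isUniform {Ω : Type*} [MeasurableSpace Ω] {P : Measure Ω}
    {X : Ω → Fin 3 → ℝ} (hX : pdf.IsUniform X (Set.Icc (0 : Fin 3 → ℝ) 1) P volume)
    {s : Set (Fin 3 → ℝ)} (hs : MeasurableSet s) (hsub : s ⊆ Set.Icc (0 : Fin 3 → ℝ) 1) :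
    P.real (X ⁻¹' s) = volume.real s := by
  rw [measureReal_def, hX.measure_preimage (by simp [volume_unitCube])
    (by simp [volume_unitCube]) hs, volume_unitCube, div_one, Set.inter_eq_right.2 hsub]
  rfl

theorem theorem1 {Ω : Type*} [MeasurableSpace Ω] (P : Measure Ω) [IsProbabilityMeasure P]
    (X : Ω → Fin 3 → ℝ)
    (hX : pdf.IsUniform X (Set.Icc (0 : Fin 3 → ℝ) 1) P volume) :
    (MeasurableSet {x : Fin 3 → ℝ | IsCyclicTuple x} ∧
      P.real {ω | IsCyclicTuple (X ω)} = pThree ∧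
      |pThree - 0.627575| < 10⁻¹ ^ 6) ∧
    (MeasurableSet {x : Fin 3 → ℝ | IsNontransitiveTuple x} ∧
      P.real {ω | IsNontransitiveTuple (X ω)} = pThreeStar ∧
      |pThreeStar - 0.011217| < 10⁻¹ ^ 6) := by
  obtain ⟨l1, l2⟩ := log_sqrt_five_sub_one_bounds
  obtain ⟨s1, s2⟩ := sqrt_five_bounds
  have t1 := Real.log_two_gt_d9
  have t2 := Real.log_two_lt_d9
  refine ⟨⟨measurableSet_isCyclicTuple, ?_, ?_⟩, measurableSet_isNontransitiveTuple, ?_, ?_⟩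
  · rw [← measureReal_isCyclicTuple]
    refine measureReal_preimage_of_isUniform hX measurableSet_isCyclicTuple ?_
    rw [setOf_isCyclicTuple]
    exact Set.sdiff_subset
  · rw [abs_lt, pThree]
    constructor <;> norm_num <;> linarith
  · rw [← measureReal_isNontransitiveTuple]
    refine measureReal_preimage_of_isUniform hX measurableSet_isNontransitiveTuple ?_
    rw [setOf_isNontransitiveTuple]
    exact Set.sdiff_subset.trans upperOctant_subset
  · rw [abs_lt, pThreeStar]
    constructor <;> norm_num <;> linarith
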